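/- Let $f:\mathbb{R}^d\to\mathbb{R}$ be differentiable and $L$-smooth with $L>0$, i.e. $f(x)\le f(y)+\langle\nabla f(y),x-y\rangle+\frac L2\|x-y\|^2$ for all $x,y$, and $(\rho,\mu)$-strongly quasar convex with $\rho,\mu>0$, i.e. for a global minimizer $w_*$ of $f$ and all $w$, $f(w_*)\ge f(w)+\frac1\rho\langle\nabla f(w),w_*-w\rangle+\frac\mu2\|w_*-w\|^2$. Let $T_0=0$ and let $T_1,T_2,\dots$ be random times whose gaps $T_{k+1}-T_k$ $(k\ge0)$ are i.i.d. exponential with mean $1$; put $dN(t)=\sum_{k\ge1}\delta_{T_k}(dt)$. Fix deterministic starting points $w_0,z_0\in\mathbb{R}^d$. (1) Let $(w_t,z_t)_{t\ge0}$, started at $(w_0,z_0)$, follow the continuized process $$dw_t=\eta_t(z_t-w_t)\,dt-\gamma_t\nabla f(w_t)\,dN(t),\qquad dz_t=\eta'_t(w_t-z_t)\,dt-\gamma'_t\nabla f(w_t)\,dN(t),$$ that is: almost surely the path is right continuous with left limits, solves $\dot w_t=\eta_t(z_t-w_t)$, $\dot z_t=\eta'_t(w_t-z_t)$ between consecutive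 times $T_k$, and satisfies $w_{T_k}=w_{T_k-}-\gamma_{T_k}\nabla f(w_{T_k-})$, $z_{T_k}=z_{T_k-}-\gamma'_{T_k}\nabla f(w_{T_k-})$ for $k\ge1$. If $\gamma_t=\frac1L$, $\gamma'_t=\frac1{\sqrt{\mu L}}$, $\eta_t=\sqrt{\frac\mu L}$ and $\eta'_t=\rho\sqrt{\frac\mu L}$, then for every $t\ge0$ the random variable $f(w_t)-f(w_*)$ is integrable and $$\mathbb{E}[f(w_t)-f(w_*)]\le\Bigl(f(w_0)-f(w_*)+\frac\mu2\|z_0-w_*\|^2\Bigr)\exp\Bigl(-\rho\sqrt{\tfrac\mu L}\,t\Bigr).$$ (2) Let $\tilde w_k,\tilde v_k,\tilde z_k$ be given by $\tilde w_0=w_0$, $\tilde z_0=z_0$ and, for $k\ge0$, $$\tilde v_k=\tilde w_k+\tau_k(\tilde z_k-\tilde w_k),\quad \tilde w_{k+1}=\tilde v_k-\tilde\gamma_{k+1}\nabla f(\tilde v_k),\quad \tilde z_{k+1}=\tilde z_k+\tau'_k(\tilde v_k-\tilde z_k)-\tilde\gamma'_{k+1}\nabla f(\tilde v_k),$$ where,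 with $E_k=\exp\bigl(-(1+\rho)\sqrt{\mu/L}\,(T_{k+1}-T_k)\bigr)$, $$\tau_k=\frac{1-E_k}{1+\rho},\qquad \tau'_k=\frac{\rho(1-E_k)}{\rho+E_k},\qquad \tilde\gamma_k=\frac1L,\qquad \tilde\gamma'_k=\frac1{\sqrt{\mu L}}.$$ Then for every $k\ge0$ the random variable $\exp\bigl(\rho\sqrt{\mu/L}\,T_k\bigr)(f(\tilde w_k)-f(w_*))$ is integrable and $$\mathbb{E}\Bigl[\exp\Bigl(\rho\sqrt{\tfrac\mu L}\,T_k\Bigr)\bigl(f(\tilde w_k)-f(w_*)\bigr)\Bigr]\le f(\tilde w_0)-f(w_*)+\frac\mu2\|\tilde z_0-w_*\|^2.$$ -/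

import Mathlib

open MeasureTheory ProbabilityTheory Filter Topology Set
open scoped Gradient RealInnerProductSpace

/-- `f` is differentiable and satisfies the quadratic upper bound with constant `L`. -/
structure IsLSmooth {d : ℕ} (L : ℝ) (f : EuclideanSpace ℝ (Fin d) → ℝ) : Prop where
  differentiable : Differentiable ℝ f
  upper_bound : ∀ x y, f x ≤ f y + ⟪∇ f y, x - y⟫ + L / 2 * ‖x - y‖ ^ 2

/-- `f` is `(ρ, μ)`-strongly quasar convex with respect to its global minimizer `wstar`. -/
structure IsStronglyQuasarConvex {d : ℕ} (ρ μ : ℝ) (f : EuclideanSpace ℝ (Fin d) → ℝ)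
    (wstar : EuclideanSpace ℝ (Fin d)) : Prop where
  minimizer : ∀ w, f wstar ≤ f w
  quasar : ∀ w, f wstar ≥ f w + 1 / ρ * ⟪∇ f w, wstar - w⟫ + μ / 2 * ‖wstar - w‖ ^ 2

/-- `T 1, T 2, …` are the points of a rate-one Poisson process on the half line: with `T 0 = 0`,
the gaps `T (k + 1) - T k` are i.i.d. exponential random variables with mean `1`. -/
structure IsPoissonClock {Ω : Type*} [MeasurableSpace Ω] (P : Measure Ω) (T : ℕ → Ω → ℝ) :
    Prop where
  measurable : ∀ k, Measurable (T k)
  zero : ∀ ω, T 0 ω = 0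
  indep : iIndepFun (fun k ω => T (k + 1) ω - T k ω) P
  law : ∀ k, HasLaw (fun ω => T (k + 1) ω - T k ω) (expMeasure 1) P

/-- `(w, z)` is a path, started at `(w₀, z₀)`, of the continuized dynamics
`dw_t = η_t (z_t - w_t) dt - γ_t ∇f(w_t) dN(t)`, `dz_t = η'_t (w_t - z_t) dt - γ'_t ∇f(w_t) dN(t)`,
where `N` is the counting measure of the jump times `T 1 < T 2 < …` (and `T 0 = 0`). The path is
right continuous with left limits at the jump times, solves the ordinary differential equations
between them, and at a jump time takes the gradient steps, computed at the left limit of `w`. -/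
structure IsContinuizedPath {d : ℕ} (f : EuclideanSpace ℝ (Fin d) → ℝ) (η η' γ γ' : ℝ → ℝ)
    (T : ℕ → ℝ) (w₀ z₀ : EuclideanSpace ℝ (Fin d)) (w z : ℝ → EuclideanSpace ℝ (Fin d)) :
    Prop where
  init_w : w 0 = w₀
  init_z : z 0 = z₀
  ode_w : ∀ k, ∀ t ∈ Ioo (T k) (T (k + 1)), HasDerivAt w (η t • (z t - w t)) t
  ode_z : ∀ k, ∀ t ∈ Ioo (T k) (T (k + 1)), HasDerivAt z (η' t • (w t - z t)) t
  right_cont_w : ∀ k, ContinuousWithinAt w (Ici (T k)) (T k)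
  right_cont_z : ∀ k, ContinuousWithinAt z (Ici (T k)) (T k)
  jump : ∀ k, ∃ wl zl : EuclideanSpace ℝ (Fin d),
    Tendsto w (𝓝[<] T (k + 1)) (𝓝 wl) ∧ Tendsto z (𝓝[<] T (k + 1)) (𝓝 zl) ∧
    w (T (k + 1)) = wl - γ (T (k + 1)) • ∇ f wl ∧
    z (T (k + 1)) = zl - γ' (T (k + 1)) • ∇ f wl

/-- `(w, v, z)` are iterates, started at `(w₀, z₀)`, of the discrete-time algorithm with
parameters `τ`, `τ'`, `γ`, `γ'` (the values `γ 0` and `γ' 0` are not used). -/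
structure IsDiscretePath {d : ℕ} (f : EuclideanSpace ℝ (Fin d) → ℝ) (τ τ' γ γ' : ℕ → ℝ)
    (w₀ z₀ : EuclideanSpace ℝ (Fin d)) (w v z : ℕ → EuclideanSpace ℝ (Fin d)) : Prop where
  init_w : w 0 = w₀
  init_z : z 0 = z₀
  step_v : ∀ k, v k = w k + τ k • (z k - w k)
  step_w : ∀ k, w (k + 1) = v k - γ (k + 1) • ∇ f (v k)
  step_z : ∀ k, z (k + 1) = z k + τ' k • (v k - z k) - γ' (k + 1) • ∇ f (v k)

/-! Put η = √(μ/L) and let V be `lyapunov`. The heart is a generator inequality,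
`drift_add_jump_le`: the drift of V plus its increment at a unit-rate jump is at most -ρηV.
Smoothness pays for the squared gradient created by the step in z, and strong quasar convexity
controls the remaining inner product. Formally, e^{ρηt}V is then a supermartingale.

Instead of stochastic calculus, the proof uses the chain of states at the jump times. Between jumps
the path is the explicit flow `mixFlow`, so it is determined by that chain and the clock.
Integrating the generator inequality against the exponential density e^{-s} up to a horizon gives a
one-step estimate (`integral_lyapunov_gradStep_le`). Independence of the next gap from the past and
Tonelli turn it into `lintegral_succ_add_le`, which telescopes in `sum_lintegral_add_le`.

Both claims concern this one chain. For (1), the contributions of the disjoint events T_k ≤ t <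
T_{k+1} are summed; they exhaust the sample space almost surely because the clock does not explode.
For (2), the index is fixed and the horizon tends to infinity. -/

/-- The flow of the linear system `w' = η (z - w)`, `z' = ρ η (w - z)`. -/
noncomputable def mixFlow {E : Type*} [AddCommGroup E] [Module ℝ E] (ρ η s : ℝ) (x : E × E) :
    E × E :=
  (x.1 + ((1 - Real.exp (-((1 + ρ) * η * s))) / (1 + ρ)) • (x.2 - x.1),
    x.2 - (ρ * (1 - Real.exp (-((1 + ρ) * η * s))) / (1 + ρ)) • (x.2 - x.1))

/-- The simultaneous gradient steps of the two variables. -/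
noncomputable def gradStep {d : ℕ} (f : EuclideanSpace ℝ (Fin d) → ℝ) (γ γ' : ℝ)
    (x : EuclideanSpace ℝ (Fin d) × EuclideanSpace ℝ (Fin d)) :
    EuclideanSpace ℝ (Fin d) × EuclideanSpace ℝ (Fin d) :=
  (x.1 - γ • ∇ f x.1, x.2 - γ' • ∇ f x.1)

/-- The Lyapunov function `f w - f w⋆ + μ / 2 * ‖z - w⋆‖ ^ 2`. -/
noncomputable def lyapunov {d : ℕ} (f : EuclideanSpace ℝ (Fin d) → ℝ)
    (wstar : EuclideanSpace ℝ (Fin d)) (μ : ℝ)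
    (x : EuclideanSpace ℝ (Fin d) × EuclideanSpace ℝ (Fin d)) : ℝ :=
  f x.1 - f wstar + μ / 2 * ‖x.2 - wstar‖ ^ 2

/-! ### The linear flow between jumps. -/

section Flow

variable {E : Type*} [NormedAddCommGroup E] [NormedSpace ℝ E]

lemma mixFlow_zero (ρ η : ℝ) (x : E × E) : mixFlow ρ η 0 x = x := by
  simp [mixFlow]

lemma hasDerivAt_mixFlow_fst {ρ : ℝ} (hρ : 0 < ρ) (η s : ℝ) (x : E × E) :
    HasDerivAt (fun s => (mixFlow ρ η s x).1)
      (η • ((mixFlow ρ η s x).2 - (mixFlow ρ η s x).1)) s := by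
  have h1 : 1 + ρ ≠ 0 := by positivity
  have h2 : HasDerivAt (fun s => (1 - Real.exp (-((1 + ρ) * η * s))) / (1 + ρ))
      (η * Real.exp (-((1 + ρ) * η * s))) s := by
    have := ((((hasDerivAt_id s).const_mul ((1 + ρ) * η)).neg.exp).const_sub 1).div_const (1 + ρ)
    refine this.congr_deriv ?_
    simp only [id, Pi.neg_apply]
    field_simp
  refine ((h2.smul_const (x.2 - x.1)).const_add x.1).congr_deriv ?_
  simp only [mixFlow]
  match_scalars <;> field_simp <;> ring

lemma hasDerivAt_mixFlow_snd {ρ : ℝ} (hρ : 0 < ρ) (η s : ℝ) (x : E × E) :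
    HasDerivAt (fun s => (mixFlow ρ η s x).2)
      ((ρ * η) • ((mixFlow ρ η s x).1 - (mixFlow ρ η s x).2)) s := by
  have h1 : 1 + ρ ≠ 0 := by positivity
  have h2 : HasDerivAt (fun s => ρ * (1 - Real.exp (-((1 + ρ) * η * s))) / (1 + ρ))
      (ρ * η * Real.exp (-((1 + ρ) * η * s))) s := by
    have := (((((hasDerivAt_id s).const_mul ((1 + ρ) * η)).neg.exp).const_sub 1).const_mul
      ρ).div_const (1 + ρ)
    refine this.congr_deriv ?_
    simp only [id, Pi.neg_apply]
    field_simp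
  refine ((h2.smul_const (x.2 - x.1)).const_sub x.2).congr_deriv ?_
  simp only [mixFlow]
  match_scalars <;> field_simp <;> ring

lemma continuous_mixFlow (ρ η : ℝ) :
    Continuous fun p : ℝ × E × E => mixFlow ρ η p.1 p.2 := by
  unfold mixFlow
  fun_prop

/-- A solution on `(a, b)` of the linear system which is right continuous at `a` is given by
the flow on `[a, b)`. -/
lemma eq_mixFlow_of_hasDerivAt {ρ η : ℝ} (hρ : 0 < ρ) {a b : ℝ} {w z : ℝ → E}
    (hw : ∀ t ∈ Ioo a b, HasDerivAt w (η • (z t - w t)) t)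
    (hz : ∀ t ∈ Ioo a b, HasDerivAt z ((ρ * η) • (w t - z t)) t)
    (hwa : ContinuousWithinAt w (Ici a) a) (hza : ContinuousWithinAt z (Ici a) a)
    {t : ℝ} (ht : t ∈ Ico a b) : (w t, z t) = mixFlow ρ η (t - a) (w a, z a) := by
  rcases ht.1.eq_or_lt with rfl | hat
  · simp [mixFlow_zero]
  have hab : a < b := hat.trans ht.2
  have hto : t ∈ Ioo a b := ⟨hat, ht.2⟩
  -- Applied to the two first integrals ρw + z and e^{(1+ρ)η(s-a)}(z - w), which together determine
  -- w and z.
  have key : ∀ {g : ℝ → E}, (∀ s ∈ Ioo a b, HasDerivAt g 0 s) →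
      ContinuousWithinAt g (Ici a) a → g t = g a := by
    intro g hg hga
    have h1 : ∀ s ∈ Ioo a b, g s = g t := fun s hs =>
      isOpen_Ioo.is_const_of_deriv_eq_zero isPreconnected_Ioo
        (fun u hu => (hg u hu).differentiableAt.differentiableWithinAt)
        (fun u hu => (hg u hu).deriv) hs hto
    have h2 : Tendsto g (𝓝[>] a) (𝓝 (g a)) := hga.mono Ioi_subset_Ici_self
    have h3 : Tendsto g (𝓝[>] a) (𝓝 (g t)) :=
      tendsto_const_nhds.congr' (by
        filter_upwards [Ioo_mem_nhdsGT hab] with s hs using (h1 s hs).symm)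
    exact tendsto_nhds_unique h3 h2
  have hsum := key (g := fun s => ρ • w s + z s)
    (fun s hs => by
      refine (((hw s hs).const_smul ρ).add (hz s hs)).congr_deriv ?_
      module)
    ((hwa.const_smul ρ).add hza)
  have hexp : ∀ s, HasDerivAt (fun s => Real.exp ((1 + ρ) * η * (s - a)))
      (Real.exp ((1 + ρ) * η * (s - a)) * ((1 + ρ) * η)) s := fun s => by
    simpa using (((hasDerivAt_id s).sub_const a).const_mul ((1 + ρ) * η)).exp
  have hdiff := key (g := fun s => Real.exp ((1 + ρ) * η * (s - a)) • (z s - w s))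
    (fun s hs => by
      refine ((hexp s).smul ((hz s hs).sub (hw s hs))).congr_deriv ?_
      simp only [Pi.sub_apply]
      module)
    ((hexp a).continuousAt.continuousWithinAt.smul (hza.sub hwa))
  simp only [sub_self, mul_zero, Real.exp_zero, one_smul] at hdiff
  have h1 : 1 + ρ ≠ 0 := by positivity
  have hd : z t - w t = Real.exp (-((1 + ρ) * η * (t - a))) • (z a - w a) := by
    rw [← hdiff, smul_smul, ← Real.exp_add]; simp
  have hwt : w t = (1 + ρ)⁻¹ • ((ρ • w t + z t) - (z t - w t)) := by
    match_scalars <;> field_simp <;> ring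
  have hzt : z t = (1 + ρ)⁻¹ • ((ρ • w t + z t) + ρ • (z t - w t)) := by
    match_scalars <;> field_simp <;> ring
  rw [hsum, hd] at hwt hzt
  ext1
  · simp only [mixFlow]
    rw [hwt]
    match_scalars <;> field_simp <;> ring
  · simp only [mixFlow]
    rw [hzt]
    match_scalars <;> field_simp <;> ring

/-- The left limit at `b` of such a solution is given by the flow as well. -/
lemma eq_mixFlow_of_tendsto_left {ρ η : ℝ} (hρ : 0 < ρ) {a b : ℝ} (hab : a < b) {w z : ℝ → E}
    (hw : ∀ t ∈ Ioo a b, HasDerivAt w (η • (z t - w t)) t)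
    (hz : ∀ t ∈ Ioo a b, HasDerivAt z ((ρ * η) • (w t - z t)) t)
    (hwa : ContinuousWithinAt w (Ici a) a) (hza : ContinuousWithinAt z (Ici a) a)
    {wl zl : E} (hwl : Tendsto w (𝓝[<] b) (𝓝 wl)) (hzl : Tendsto z (𝓝[<] b) (𝓝 zl)) :
    (wl, zl) = mixFlow ρ η (b - a) (w a, z a) := by
  have h1 : Tendsto (fun t => (w t, z t)) (𝓝[<] b) (𝓝 (wl, zl)) := hwl.prodMk_nhds hzl
  have h2 : Continuous fun t : ℝ => mixFlow ρ η (t - a) (w a, z a) :=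
    (continuous_mixFlow ρ η).comp
      ((continuous_id.sub continuous_const).prodMk continuous_const)
  have h3 : Tendsto (fun t => (w t, z t)) (𝓝[<] b) (𝓝 (mixFlow ρ η (b - a) (w a, z a))) :=
    ((h2.tendsto b).mono_left nhdsWithin_le_nhds).congr' (by
      filter_upwards [Ioo_mem_nhdsLT hab] with t ht
      exact (eq_mixFlow_of_hasDerivAt hρ hw hz hwa hza (Ioo_subset_Ico_self ht)).symm)
  exact tendsto_nhds_unique h1 h3

end Flow

/-! ### Decrease of the Lyapunov function under drift and gradient steps. -/

section Lyapunov

variable {d : ℕ} {L ρ μ η γ' : ℝ} {f : EuclideanSpace ℝ (Fin d) → ℝ}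
  {wstar : EuclideanSpace ℝ (Fin d)}

lemma measurable_gradient : Measurable (∇ f) :=
  (InnerProductSpace.toDual ℝ (EuclideanSpace ℝ (Fin d))).symm.continuous.measurable.comp
    (measurable_fderiv ℝ f)

lemma measurable_gradStep (γ γ' : ℝ) : Measurable (gradStep f γ γ') := by
  have h : Measurable (∇ f) := measurable_gradient
  unfold gradStep
  fun_prop

lemma measurable_mixFlow (ρ η : ℝ) : Measurable fun p :
    ℝ × EuclideanSpace ℝ (Fin d) × EuclideanSpace ℝ (Fin d) => mixFlow ρ η p.1 p.2 :=
  (continuous_mixFlow ρ η).measurable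

lemma IsLSmooth.continuous_lyapunov (hf : IsLSmooth L f) : Continuous (lyapunov f wstar μ) := by
  have := hf.differentiable.continuous
  unfold lyapunov
  fun_prop

lemma IsStronglyQuasarConvex.lyapunov_nonneg (hq : IsStronglyQuasarConvex ρ μ f wstar)
    (hμ : 0 < μ) (x : EuclideanSpace ℝ (Fin d) × EuclideanSpace ℝ (Fin d)) :
    0 ≤ lyapunov f wstar μ x := by
  have := hq.minimizer x.1
  unfold lyapunov
  have : 0 ≤ μ / 2 * ‖x.2 - wstar‖ ^ 2 := by positivity
  linarith

lemma IsLSmooth.gradient_step_le (hf : IsLSmooth L f) (hL : 0 < L) (w : EuclideanSpace ℝ (Fin d)) :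
    f (w - (1 / L) • ∇ f w) ≤ f w - 1 / (2 * L) * ‖∇ f w‖ ^ 2 := by
  have h := hf.upper_bound (w - (1 / L) • ∇ f w) w
  rw [sub_sub_cancel_left, inner_neg_right, inner_smul_right, norm_neg, norm_smul,
    real_inner_self_eq_norm_sq, mul_pow, Real.norm_eq_abs, sq_abs] at h
  refine h.trans_eq ?_
  field_simp
  ring

/-- A gradient step cannot go below the minimum, so ‖∇f‖² ≤ 2L(f - f⋆); Young's inequality does the
rest. The right side is continuous in (w, v), which later supplies an integrable majorant without
continuity of the gradient. -/
lemma IsStronglyQuasarConvex.neg_inner_gradient_le (hq : IsStronglyQuasarConvex ρ μ f wstar)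
    (hf : IsLSmooth L f) (hL : 0 < L) (w v : EuclideanSpace ℝ (Fin d)) :
    -⟪∇ f w, v⟫ ≤ L * (f w - f wstar) + ‖v‖ ^ 2 / 2 := by
  have h1 := (hq.minimizer _).trans (hf.gradient_step_le hL w)
  have h2 : ‖∇ f w‖ ^ 2 / 2 = L * (1 / (2 * L) * ‖∇ f w‖ ^ 2) := by field_simp
  have h3 : ‖∇ f w‖ ^ 2 / 2 ≤ L * (f w - f wstar) := by
    rw [h2]
    exact mul_le_mul_of_nonneg_left (by linarith) hL.le
  have h4 := norm_add_sq_real (∇ f w) v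
  nlinarith [sq_nonneg ‖∇ f w + v‖]

/-- Effect of the gradient steps on the Lyapunov function. -/
lemma IsLSmooth.lyapunov_gradStep_le (hf : IsLSmooth L f) (hL : 0 < L)
    (h1 : μ * γ' = η) (h2 : μ * γ' ^ 2 = 1 / L)
    (x : EuclideanSpace ℝ (Fin d) × EuclideanSpace ℝ (Fin d)) :
    lyapunov f wstar μ (gradStep f (1 / L) γ' x) ≤
      lyapunov f wstar μ x - η * ⟪∇ f x.1, x.2 - wstar⟫ := by
  have h := hf.gradient_step_le hL x.1
  have h3 : ‖x.2 - γ' • ∇ f x.1 - wstar‖ ^ 2 =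
      ‖x.2 - wstar‖ ^ 2 - 2 * γ' * ⟪∇ f x.1, x.2 - wstar⟫ + γ' ^ 2 * ‖∇ f x.1‖ ^ 2 := by
    rw [sub_right_comm, norm_sub_sq_real, inner_smul_right, norm_smul, mul_pow, Real.norm_eq_abs,
      sq_abs, real_inner_comm]
    ring
  simp only [lyapunov, gradStep]
  rw [h3]
  -- The choice μγ'² = 1/L makes the descent gain in f cancel the quadratic term of the z-step
  -- exactly.
  have h4 : 1 / (2 * L) * ‖∇ f x.1‖ ^ 2 = μ * γ' ^ 2 / 2 * ‖∇ f x.1‖ ^ 2 := by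
    rw [h2]; field_simp
  rw [h4] at h
  rw [← h1]
  linarith

/-- The infinitesimal decrease of the Lyapunov function under drift and unit rate jumps. -/
lemma drift_add_jump_le (hf : IsLSmooth L f) (hq : IsStronglyQuasarConvex ρ μ f wstar)
    (hL : 0 < L) (hρ : 0 < ρ) (hμ : 0 < μ) (hη : 0 ≤ η) (h1 : μ * γ' = η)
    (h2 : μ * γ' ^ 2 = 1 / L) (x : EuclideanSpace ℝ (Fin d) × EuclideanSpace ℝ (Fin d)) :
    ρ * η * lyapunov f wstar μ x +
      (⟪∇ f x.1, η • (x.2 - x.1)⟫ + μ * ⟪x.2 - wstar, (ρ * η) • (x.1 - x.2)⟫) +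
      (lyapunov f wstar μ (gradStep f (1 / L) γ' x) - lyapunov f wstar μ x) ≤ 0 := by
  have hj := hf.lyapunov_gradStep_le (wstar := wstar) hL h1 h2 x
  have hq' := hq.quasar x.1
  have hq2 : ⟪∇ f x.1, wstar - x.1⟫ ≤
      ρ * (f wstar - f x.1 - μ / 2 * ‖wstar - x.1‖ ^ 2) := by
    have : ρ * (1 / ρ * ⟪∇ f x.1, wstar - x.1⟫) = ⟪∇ f x.1, wstar - x.1⟫ := by field_simp
    nlinarith
  have hq3 := mul_le_mul_of_nonneg_left hq2 hη
  -- The drift of w and the jump of z combine so that z disappears, leaving the inner product that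
  -- quasar convexity bounds.
  have e1 : ⟪∇ f x.1, η • (x.2 - x.1)⟫ - η * ⟪∇ f x.1, x.2 - wstar⟫ =
      η * ⟪∇ f x.1, wstar - x.1⟫ := by
    rw [inner_smul_right, ← mul_sub, ← inner_sub_right]
    congr 2
    abel
  -- Polarization: the first square cancels the strong convexity term and the second cancels the
  -- quadratic part of ρηV. Only a negative multiple of ‖w - z‖² is left.
  have e2 : ⟪x.2 - wstar, x.1 - x.2⟫ = (‖wstar - x.1‖ ^ 2 - ‖x.2 - wstar‖ ^ 2 -
      ‖x.1 - x.2‖ ^ 2) / 2 := by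
    have := norm_add_sq_real (x.2 - wstar) (x.1 - x.2)
    rw [show x.2 - wstar + (x.1 - x.2) = -(wstar - x.1) by abel, norm_neg] at this
    linarith
  have hpos : 0 ≤ μ * (ρ * η) * ‖x.1 - x.2‖ ^ 2 := by positivity
  rw [inner_smul_right (x.2 - wstar), e2]
  simp only [lyapunov] at hj ⊢
  nlinarith

lemma IsLSmooth.hasDerivAt_lyapunov_mixFlow (hf : IsLSmooth L f) (hρ : 0 < ρ)
    (x : EuclideanSpace ℝ (Fin d) × EuclideanSpace ℝ (Fin d)) (s : ℝ) :
    HasDerivAt (fun s => lyapunov f wstar μ (mixFlow ρ η s x))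
      (⟪∇ f (mixFlow ρ η s x).1, η • ((mixFlow ρ η s x).2 - (mixFlow ρ η s x).1)⟫ +
        μ * ⟪(mixFlow ρ η s x).2 - wstar,
          (ρ * η) • ((mixFlow ρ η s x).1 - (mixFlow ρ η s x).2)⟫) s := by
  have hg := (hf.differentiable (mixFlow ρ η s x).1).hasGradientAt.hasFDerivAt
  have h1 := hg.comp_hasDerivAt s (hasDerivAt_mixFlow_fst hρ η s x)
  have h2 := ((hasDerivAt_mixFlow_snd hρ η s x).sub_const wstar).norm_sq
  refine ((h1.sub_const (f wstar)).add (h2.const_mul (μ / 2))).congr_deriv ?_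
  simp only [InnerProductSpace.toDual_apply_apply]
  ring

/-- Integrated form of the decrease: the expected Lyapunov function after a unit rate exponential
time, truncated at `r`. -/
lemma integral_lyapunov_gradStep_le (hf : IsLSmooth L f) (hq : IsStronglyQuasarConvex ρ μ f wstar)
    (hL : 0 < L) (hρ : 0 < ρ) (hμ : 0 < μ) (hη : 0 ≤ η) (h1 : μ * γ' = η)
    (h2 : μ * γ' ^ 2 = 1 / L) (x : EuclideanSpace ℝ (Fin d) × EuclideanSpace ℝ (Fin d))
    {r : ℝ} (hr : 0 ≤ r) :
    IntegrableOn (fun s => Real.exp ((ρ * η - 1) * s) *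
      lyapunov f wstar μ (gradStep f (1 / L) γ' (mixFlow ρ η s x))) (Icc 0 r) ∧
    (∫ s in (0 : ℝ)..r, Real.exp ((ρ * η - 1) * s) *
      lyapunov f wstar μ (gradStep f (1 / L) γ' (mixFlow ρ η s x))) +
      Real.exp ((ρ * η - 1) * r) * lyapunov f wstar μ (mixFlow ρ η r x) ≤
      lyapunov f wstar μ x := by
  set a := ρ * η with ha
  set D : ℝ → ℝ := fun s =>
    (⟪∇ f (mixFlow ρ η s x).1, η • ((mixFlow ρ η s x).2 - (mixFlow ρ η s x).1)⟫ +
        μ * ⟪(mixFlow ρ η s x).2 - wstar,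
          (ρ * η) • ((mixFlow ρ η s x).1 - (mixFlow ρ η s x).2)⟫) with hD
  have hexp : ∀ s, HasDerivAt (fun s => Real.exp ((a - 1) * s))
      (Real.exp ((a - 1) * s) * (a - 1)) s := fun s => by
    simpa using ((hasDerivAt_id s).const_mul (a - 1)).exp
  have hder : ∀ s, HasDerivAt
      (fun s => Real.exp ((a - 1) * s) * lyapunov f wstar μ (mixFlow ρ η s x))
      (Real.exp ((a - 1) * s) * (a - 1) * lyapunov f wstar μ (mixFlow ρ η s x) +
        Real.exp ((a - 1) * s) * D s) s := fun s =>
    (hexp s).mul (hf.hasDerivAt_lyapunov_mixFlow hρ x s)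
  -- In the exponent a - 1, a is the weight e^{as} and -1 the survival probability e^{-s}, whose
  -- derivative supplies the -V of the jump increment.
  have hbound : ∀ s, Real.exp ((a - 1) * s) *
      lyapunov f wstar μ (gradStep f (1 / L) γ' (mixFlow ρ η s x)) ≤
      -(Real.exp ((a - 1) * s) * (a - 1) * lyapunov f wstar μ (mixFlow ρ η s x) +
        Real.exp ((a - 1) * s) * D s) := fun s => by
    have h := drift_add_jump_le hf hq hL hρ hμ hη h1 h2 (mixFlow ρ η s x)
    have := mul_le_mul_of_nonneg_left h (Real.exp_pos ((a - 1) * s)).le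
    simp only [hD, ha] at *
    linarith
  have hflow : Continuous fun s : ℝ => mixFlow ρ η s x :=
    (continuous_mixFlow ρ η).comp (continuous_id.prodMk continuous_const)
  have hmeas : Measurable fun s => Real.exp ((a - 1) * s) *
      lyapunov f wstar μ (gradStep f (1 / L) γ' (mixFlow ρ η s x)) := by
    refine Measurable.mul (by fun_prop) ?_
    exact hf.continuous_lyapunov.measurable.comp
      ((measurable_gradStep _ _).comp hflow.measurable)
  have hcont : Continuous fun s => Real.exp ((a - 1) * s) *
      (lyapunov f wstar μ (mixFlow ρ η s x) +
        η * (L * (f (mixFlow ρ η s x).1 - f wstar) +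
          ‖(mixFlow ρ η s x).2 - wstar‖ ^ 2 / 2)) := by
    have h3 := hf.continuous_lyapunov (wstar := wstar) (μ := μ)
    have h4 := hf.differentiable.continuous
    fun_prop
  have hint : IntegrableOn (fun s => Real.exp ((a - 1) * s) *
      lyapunov f wstar μ (gradStep f (1 / L) γ' (mixFlow ρ η s x))) (Icc 0 r) := by
    refine Integrable.mono' (hcont.integrableOn_Icc) hmeas.aestronglyMeasurable
      (Eventually.of_forall fun s => ?_)
    rw [Real.norm_of_nonneg (mul_nonneg (Real.exp_pos _).le (hq.lyapunov_nonneg hμ _))]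
    refine mul_le_mul_of_nonneg_left ?_ (Real.exp_pos _).le
    refine (hf.lyapunov_gradStep_le hL h1 h2 _).trans ?_
    rw [sub_eq_add_neg, ← mul_neg]
    gcongr
    exact hq.neg_inner_gradient_le hf hL _ _
  refine ⟨hint, ?_⟩
  -- This one-sided fundamental theorem needs integrability of the lower bound only, not of the
  -- derivative.
  have := intervalIntegral.integral_le_sub_of_hasDeriv_right_of_le hr
    (g := fun s => -(Real.exp ((a - 1) * s) * lyapunov f wstar μ (mixFlow ρ η s x)))
    (fun s _ => (hder s).neg.continuousAt.continuousWithinAt)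
    (fun s _ => (hder s).neg.hasDerivWithinAt) hint (fun s _ => hbound s)
  simp only [mul_zero, Real.exp_zero, mixFlow_zero, one_mul] at this
  linarith

end Lyapunov

/-! ### Recursions driven by independent noise. -/

section RandomRecursion

variable {Ω X : Type*} [MeasurableSpace X] {Φ : ℝ × X → X} {ξ : ℕ → Ω → ℝ} {Y : ℕ → Ω → X} {x₀ : X}

/-- Step n uses only the noise with index below n; this form lets independence of disjoint finite
blocks apply. -/
lemma exists_measurable_eq_of_recursion (hΦ : Measurable Φ) (h0 : ∀ ω, Y 0 ω = x₀)
    (hs : ∀ n ω, Y (n + 1) ω = Φ (ξ n ω, Y n ω)) (n : ℕ) :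
    ∃ F : (Finset.range n → ℝ) → X, Measurable F ∧ ∀ ω, Y n ω = F fun i => ξ i ω := by
  induction n with
  | zero => exact ⟨fun _ => x₀, measurable_const, h0⟩
  | succ n ih =>
    obtain ⟨F, hF, hY⟩ := ih
    refine ⟨fun p => Φ (p ⟨n, Finset.self_mem_range_succ n⟩,
      F fun i => p ⟨i, Finset.mem_range.2 ((Finset.mem_range.1 i.2).trans n.lt_succ_self)⟩),
      ?_, fun ω => ?_⟩
    · refine hΦ.comp ((measurable_pi_apply _).prodMk (hF.comp ?_))
      exact measurable_pi_lambda _ fun i => measurable_pi_apply _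
    · rw [hs, hY]

variable [MeasurableSpace Ω] {P : Measure Ω}

lemma measurable_of_recursion (hΦ : Measurable Φ) (h0 : ∀ ω, Y 0 ω = x₀)
    (hs : ∀ n ω, Y (n + 1) ω = Φ (ξ n ω, Y n ω)) (hξ : ∀ n, Measurable (ξ n)) (n : ℕ) :
    Measurable (Y n) := by
  obtain ⟨F, hF, hY⟩ := exists_measurable_eq_of_recursion hΦ h0 hs n
  rw [funext hY]
  exact hF.comp (measurable_pi_lambda _ fun i => hξ i)

/-- A recursion driven by independent noise is independent of the next noise variable. -/
lemma indepFun_of_recursion (hΦ : Measurable Φ) (h0 : ∀ ω, Y 0 ω = x₀)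
    (hs : ∀ n ω, Y (n + 1) ω = Φ (ξ n ω, Y n ω)) (hξ : ∀ n, Measurable (ξ n))
    (hind : iIndepFun ξ P) (n : ℕ) : IndepFun (Y n) (ξ n) P := by
  obtain ⟨F, hF, hY⟩ := exists_measurable_eq_of_recursion hΦ h0 hs n
  have h := hind.indepFun_finset (Finset.range n) {n} (by simp) hξ
  have h2 := h.comp hF (measurable_pi_apply (⟨n, Finset.mem_singleton_self n⟩ : ({n} : Finset ℕ)))
  rw [funext hY]
  exact h2

end RandomRecursion

/-! ### The exponential law and non-explosion of the clock. -/

section Clock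

lemma expMeasure_Iic_zero (r : ℝ) : expMeasure r (Iic 0) = 0 := by
  rw [expMeasure, gammaMeasure, withDensity_apply _ measurableSet_Iic,
    setLIntegral_congr Iio_ae_eq_Iic.symm]
  exact lintegral_exponentialPDF_of_nonpos le_rfl

lemma expMeasure_one_Ioi {r : ℝ} (hr : 0 ≤ r) :
    expMeasure 1 (Ioi r) = ENNReal.ofReal (Real.exp (-r)) := by
  have := isProbabilityMeasure_expMeasure one_pos
  have h := cdf_expMeasure_eq one_pos r
  rw [if_pos hr, one_mul, cdf_eq_real] at h
  rw [← compl_Iic, ← ofReal_measureReal, measureReal_compl measurableSet_Iic, h]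
  simp

lemma setLIntegral_expMeasure_one_Iic {r : ℝ} (hr : 0 ≤ r) {g : ℝ → ℝ} (hg : Measurable g)
    (hg0 : ∀ s, 0 ≤ g s)
    (hint : IntegrableOn (fun s => Real.exp (-s) * g s) (Icc 0 r)) :
    ∫⁻ s in Iic r, ENNReal.ofReal (g s) ∂expMeasure 1 =
      ENNReal.ofReal (∫ s in (0 : ℝ)..r, Real.exp (-s) * g s) := by
  have hpdf : Measurable (gammaPDF 1 1) := (measurable_gammaPDFReal 1 1).ennreal_ofReal
  rw [intervalIntegral.integral_of_le hr, ← integral_Icc_eq_integral_Ioc,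
    ofReal_integral_eq_lintegral_ofReal hint
      (Eventually.of_forall fun s => mul_nonneg (Real.exp_pos _).le (hg0 s)),
    expMeasure, gammaMeasure, restrict_withDensity measurableSet_Iic,
    lintegral_withDensity_eq_lintegral_mul _ hpdf hg.ennreal_ofReal,
    ← lintegral_indicator measurableSet_Iic, ← lintegral_indicator measurableSet_Icc]
  congr 1 with s
  by_cases hs : 0 ≤ s
  · by_cases hsr : s ≤ r
    · have h := exponentialPDF_of_nonneg (r := 1) hs
      rw [one_mul, one_mul] at h
      rw [indicator_of_mem (mem_Iic.2 hsr), indicator_of_mem (show s ∈ Icc 0 r from ⟨hs, hsr⟩),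
        ENNReal.ofReal_mul (Real.exp_pos _).le, ← h]
      rfl
    · rw [indicator_of_notMem (by simpa using hsr), indicator_of_notMem (by simp [hsr])]
  · rw [indicator_of_notMem (s := Icc 0 r) (by simp [hs])]
    have h : gammaPDF 1 1 s = 0 := gammaPDF_of_neg (not_le.1 hs)
    by_cases hsr : s ∈ Iic r
    · rw [indicator_of_mem hsr, Pi.mul_apply, h, zero_mul]
    · rw [indicator_of_notMem hsr]

variable {Ω : Type*} [MeasurableSpace Ω] {P : Measure Ω} {T : ℕ → Ω → ℝ}

lemma IsPoissonClock.measurable_gap (hT : IsPoissonClock P T) (k : ℕ) :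
    Measurable fun ω => T (k + 1) ω - T k ω :=
  (hT.measurable _).sub (hT.measurable _)

lemma IsPoissonClock.ae_lt (hT : IsPoissonClock P T) : ∀ᵐ ω ∂P, ∀ k, T k ω < T (k + 1) ω := by
  refine ae_all_iff.2 fun k => ?_
  have h : ∀ᵐ s ∂expMeasure 1, 0 < s := by
    rw [ae_iff]
    simp only [not_lt]
    exact expMeasure_Iic_zero 1
  rw [← (hT.law k).map_eq] at h
  filter_upwards [ae_of_ae_map (hT.law k).aemeasurable h] with ω hω
  linarith

/-- The strong law is applied to the gaps truncated to [0, 1]: they are trivially integrable, their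
mean is positive, and their sums bound T n from below. Hence every t ≥ 0 lies between two
consecutive jump times. -/
lemma IsPoissonClock.ae_tendsto_atTop [IsProbabilityMeasure P] (hT : IsPoissonClock P T) :
    ∀ᵐ ω ∂P, Tendsto (fun k => T k ω) atTop atTop := by
  set ξ : ℕ → Ω → ℝ := fun k ω => T (k + 1) ω - T k ω with hξ
  set X : ℕ → Ω → ℝ := fun k ω => max 0 (min (ξ k ω) 1) with hX
  have hφ : Measurable fun s : ℝ => max 0 (min s 1) := by fun_prop
  have hXm : ∀ k, Measurable (X k) := fun k => hφ.comp (hT.measurable_gap k)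
  have hb : ∀ k ω, ‖X k ω‖ ≤ 1 := fun k ω => by
    rw [Real.norm_of_nonneg (le_max_left _ _)]
    exact max_le zero_le_one (min_le_right _ _)
  have hXi : ∀ k, Integrable (X k) P := fun k =>
    Integrable.of_bound (hXm k).aestronglyMeasurable 1 (Eventually.of_forall (hb k))
  have hind : Pairwise fun i j => IndepFun (X i) (X j) P := fun i j hij =>
    (hT.indep.indepFun hij).comp hφ hφ
  have hid : ∀ i, IdentDistrib (X i) (X 0) P P := fun i =>
    IdentDistrib.comp (f := ξ i) (g := ξ 0) ⟨(hT.measurable_gap i).aemeasurable,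
      (hT.measurable_gap 0).aemeasurable, (hT.law i).map_eq.trans (hT.law 0).map_eq.symm⟩ hφ
  have hpos : 0 < ∫ ω, X 0 ω ∂P := by
    rw [integral_pos_iff_support_of_nonneg (f := X 0) (fun ω => le_max_left _ _) (hXi 0)]
    have : ∀ᵐ ω ∂P, ω ∈ Function.support (X 0) := by
      filter_upwards [hT.ae_lt] with ω hω
      have h0 : 0 < ξ 0 ω := sub_pos.2 (hω 0)
      exact (lt_max_of_lt_right (lt_min h0 one_pos)).ne'
    have hone : P (Function.support (X 0)) = P univ := measure_congr (eventuallyEq_univ.2 this)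
    rw [hone]
    simp
  filter_upwards [strong_law_ae_real X (hXi 0) hind hid, hT.ae_lt] with ω hω hlt
  have h1 := hω.pos_mul_atTop hpos tendsto_natCast_atTop_atTop
  refine tendsto_atTop_mono' _ ?_ h1
  filter_upwards [eventually_gt_atTop 0] with n hn
  have hn' : (n : ℝ) ≠ 0 := by positivity
  rw [div_mul_cancel₀ _ hn']
  have h2 : ∑ i ∈ Finset.range n, ξ i ω = T n ω - T 0 ω :=
    Finset.sum_range_sub (fun i => T i ω) n
  rw [hT.zero, sub_zero] at h2
  rw [← h2]
  exact Finset.sum_le_sum fun i _ => max_le (sub_pos.2 (hlt i)).le (min_le_left _ _)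

end Clock

/-! ### The jump chain and its telescoping estimate. -/

/-- The states at the times `T 0, T 1, …` of the process which follows `mixFlow` between these times
and takes gradient steps at the times `T 1, T 2, …`. -/
noncomputable def jumpChain {d : ℕ} (f : EuclideanSpace ℝ (Fin d) → ℝ) (ρ η γ γ' : ℝ) (T : ℕ → ℝ)
    (x₀ : EuclideanSpace ℝ (Fin d) × EuclideanSpace ℝ (Fin d)) :
    ℕ → EuclideanSpace ℝ (Fin d) × EuclideanSpace ℝ (Fin d)
  | 0 => x₀
  | n + 1 => gradStep f γ γ' (mixFlow ρ η (T (n + 1) - T n) (jumpChain f ρ η γ γ' T x₀ n))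

section Chain

variable {d : ℕ} {L ρ μ η γ' : ℝ} {f : EuclideanSpace ℝ (Fin d) → ℝ}
  {wstar : EuclideanSpace ℝ (Fin d)}

/-- The expected weighted Lyapunov function at the minimum of `r` and an exponential time. -/
lemma lintegral_expMeasure_lyapunov_le (hf : IsLSmooth L f)
    (hq : IsStronglyQuasarConvex ρ μ f wstar)
    (hL : 0 < L) (hρ : 0 < ρ) (hμ : 0 < μ) (hη : 0 ≤ η) (h1 : μ * γ' = η)
    (h2 : μ * γ' ^ 2 = 1 / L) (x : EuclideanSpace ℝ (Fin d) × EuclideanSpace ℝ (Fin d))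
    {r : ℝ} (hr : 0 ≤ r) :
    ∫⁻ s, (if s ≤ r then ENNReal.ofReal (Real.exp (ρ * η * s) *
        lyapunov f wstar μ (gradStep f (1 / L) γ' (mixFlow ρ η s x)))
      else ENNReal.ofReal (Real.exp (ρ * η * r) * lyapunov f wstar μ (mixFlow ρ η r x)))
      ∂expMeasure 1 ≤ ENNReal.ofReal (lyapunov f wstar μ x) := by
  obtain ⟨hint, hle⟩ := integral_lyapunov_gradStep_le hf hq hL hρ hμ hη h1 h2 x hr
  set g : ℝ → ℝ := fun s => Real.exp (ρ * η * s) *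
    lyapunov f wstar μ (gradStep f (1 / L) γ' (mixFlow ρ η s x)) with hg
  have hgm : Measurable g := by
    refine Measurable.mul (by fun_prop) ?_
    exact hf.continuous_lyapunov.measurable.comp ((measurable_gradStep _ _).comp
      ((measurable_mixFlow ρ η).comp (measurable_id.prodMk measurable_const)))
  have hg0 : ∀ s, 0 ≤ g s := fun s => mul_nonneg (Real.exp_pos _).le (hq.lyapunov_nonneg hμ _)
  have hexp : ∀ s, Real.exp ((ρ * η - 1) * s) = Real.exp (-s) * Real.exp (ρ * η * s) := fun s => by
    rw [← Real.exp_add]; ring_nf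
  simp only [hexp, mul_assoc (Real.exp (-_))] at hint hle
  have hV := hq.lyapunov_nonneg hμ (mixFlow ρ η r x)
  rw [← lintegral_add_compl _ (measurableSet_Iic (a := r)), compl_Iic]
  have e1 : ∫⁻ s in Iic r, (if s ≤ r then ENNReal.ofReal (g s)
      else ENNReal.ofReal (Real.exp (ρ * η * r) * lyapunov f wstar μ (mixFlow ρ η r x)))
      ∂expMeasure 1 = ∫⁻ s in Iic r, ENNReal.ofReal (g s) ∂expMeasure 1 :=
    setLIntegral_congr_fun measurableSet_Iic fun s hs => if_pos hs
  have e2 : ∫⁻ s in Ioi r, (if s ≤ r then ENNReal.ofReal (g s)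
      else ENNReal.ofReal (Real.exp (ρ * η * r) * lyapunov f wstar μ (mixFlow ρ η r x)))
      ∂expMeasure 1 = ENNReal.ofReal (Real.exp (ρ * η * r) *
        lyapunov f wstar μ (mixFlow ρ η r x)) * expMeasure 1 (Ioi r) := by
    rw [← setLIntegral_const]
    exact setLIntegral_congr_fun measurableSet_Ioi fun s hs => if_neg (not_le.2 hs)
  rw [e1, e2, expMeasure_one_Ioi hr, setLIntegral_expMeasure_one_Iic hr hgm hg0 hint,
    ← ENNReal.ofReal_mul (mul_nonneg (Real.exp_pos _).le hV), ← ENNReal.ofReal_add]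
  · refine ENNReal.ofReal_le_ofReal (le_trans (le_of_eq ?_) hle)
    ring
  · exact intervalIntegral.integral_nonneg hr fun s _ => mul_nonneg (Real.exp_pos _).le (hg0 s)
  · have := Real.exp_pos (ρ * η * r)
    have := Real.exp_pos (-r)
    positivity

variable {Ω : Type*} [MeasurableSpace Ω] {P : Measure Ω} {T : ℕ → Ω → ℝ}

/-- The time is carried as part of the state, so that the pair (T n, chain) is a recursion driven by
the gaps alone. -/
lemma measurable_recursionStep (ρ η γ γ' : ℝ) : Measurable fun p :
    ℝ × ℝ × EuclideanSpace ℝ (Fin d) × EuclideanSpace ℝ (Fin d) =>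
      (p.2.1 + p.1, gradStep f γ γ' (mixFlow ρ η p.1 p.2.2)) := by
  refine Measurable.prodMk (by fun_prop) ((measurable_gradStep γ γ').comp ?_)
  exact (measurable_mixFlow ρ η).comp
    (measurable_fst.prodMk (measurable_snd.comp measurable_snd))

lemma IsPoissonClock.measurable_jumpChain (hT : IsPoissonClock P T) (ρ η γ γ' : ℝ)
    (x₀ : EuclideanSpace ℝ (Fin d) × EuclideanSpace ℝ (Fin d)) (n : ℕ) :
    Measurable fun ω => jumpChain f ρ η γ γ' (fun k => T k ω) x₀ n := by
  have h := measurable_of_recursion (ξ := fun n ω => T (n + 1) ω - T n ω)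
    (Y := fun n ω => (T n ω, jumpChain f ρ η γ γ' (fun k => T k ω) x₀ n)) (x₀ := (0, x₀))
    (measurable_recursionStep (f := f) ρ η γ γ') (fun ω => by simp [hT.zero, jumpChain])
    (fun n ω => by simp [jumpChain]) hT.measurable_gap n
  exact measurable_snd.comp h

lemma IsPoissonClock.indepFun_jumpChain (hT : IsPoissonClock P T) (ρ η γ γ' : ℝ)
    (x₀ : EuclideanSpace ℝ (Fin d) × EuclideanSpace ℝ (Fin d)) (n : ℕ) :
    IndepFun (fun ω => (T n ω, jumpChain f ρ η γ γ' (fun k => T k ω) x₀ n))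
      (fun ω => T (n + 1) ω - T n ω) P :=
  indepFun_of_recursion (ξ := fun n ω => T (n + 1) ω - T n ω)
    (Y := fun n ω => (T n ω, jumpChain f ρ η γ γ' (fun k => T k ω) x₀ n)) (x₀ := (0, x₀))
    (measurable_recursionStep (f := f) ρ η γ γ') (fun ω => by simp [hT.zero, jumpChain])
    (fun n ω => by simp [jumpChain]) hT.measurable_gap hT.indep n

/-- One step of the chain: the expected weighted Lyapunov function at the next jump time or at the
horizon `t`, whichever comes first, is at most the current one. -/
lemma IsPoissonClock.lintegral_succ_add_le [IsProbabilityMeasure P] (hT : IsPoissonClock P T)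
    (hf : IsLSmooth L f) (hq : IsStronglyQuasarConvex ρ μ f wstar)
    (hL : 0 < L) (hρ : 0 < ρ) (hμ : 0 < μ) (hη : 0 ≤ η) (h1 : μ * γ' = η)
    (h2 : μ * γ' ^ 2 = 1 / L) (x₀ : EuclideanSpace ℝ (Fin d) × EuclideanSpace ℝ (Fin d))
    (t : ℝ) (n : ℕ) :
    ∫⁻ ω, (if T (n + 1) ω ≤ t then ENNReal.ofReal (Real.exp (ρ * η * T (n + 1) ω) *
        lyapunov f wstar μ (jumpChain f ρ η (1 / L) γ' (fun k => T k ω) x₀ (n + 1))) else 0) ∂P +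
    ∫⁻ ω, (if T n ω ≤ t ∧ t < T (n + 1) ω then ENNReal.ofReal (Real.exp (ρ * η * t) *
        lyapunov f wstar μ (mixFlow ρ η (t - T n ω)
          (jumpChain f ρ η (1 / L) γ' (fun k => T k ω) x₀ n))) else 0) ∂P ≤
    ∫⁻ ω, (if T n ω ≤ t then ENNReal.ofReal (Real.exp (ρ * η * T n ω) *
        lyapunov f wstar μ (jumpChain f ρ η (1 / L) γ' (fun k => T k ω) x₀ n)) else 0) ∂P := by
  set a := ρ * η with ha
  set Y := fun ω => jumpChain f ρ η (1 / L) γ' (fun k => T k ω) x₀ n with hY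
  set ξ := fun ω => T (n + 1) ω - T n ω with hξ
  have hVm : Measurable (lyapunov f wstar μ) := hf.continuous_lyapunov.measurable
  have hYm : Measurable Y := hT.measurable_jumpChain ρ η (1 / L) γ' x₀ n
  have hξm : Measurable ξ := hT.measurable_gap n
  have hTm := hT.measurable
  -- `H` merges the two left-hand integrands, whose events are disjoint, into one function of the
  -- present state and the next gap. The factor e^{aT_n} is split off so that the inner integral is
  -- the one-step estimate with r = t - T_n.
  set H : (ℝ × EuclideanSpace ℝ (Fin d) × EuclideanSpace ℝ (Fin d)) × ℝ → ENNReal := fun p =>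
    if p.1.1 ≤ t then
      ENNReal.ofReal (Real.exp (a * p.1.1)) *
        (if p.2 ≤ t - p.1.1 then ENNReal.ofReal (Real.exp (a * p.2) *
          lyapunov f wstar μ (gradStep f (1 / L) γ' (mixFlow ρ η p.2 p.1.2)))
        else ENNReal.ofReal (Real.exp (a * (t - p.1.1)) *
          lyapunov f wstar μ (mixFlow ρ η (t - p.1.1) p.1.2)))
    else 0 with hH
  have hHm : Measurable H := by
    have hm1 : Measurable fun p :
        (ℝ × EuclideanSpace ℝ (Fin d) × EuclideanSpace ℝ (Fin d)) × ℝ =>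
          lyapunov f wstar μ (gradStep f (1 / L) γ' (mixFlow ρ η p.2 p.1.2)) :=
      hVm.comp ((measurable_gradStep _ _).comp ((measurable_mixFlow ρ η).comp
        (measurable_snd.prodMk (measurable_snd.comp measurable_fst))))
    have hm2 : Measurable fun p :
        (ℝ × EuclideanSpace ℝ (Fin d) × EuclideanSpace ℝ (Fin d)) × ℝ =>
          lyapunov f wstar μ (mixFlow ρ η (t - p.1.1) p.1.2) :=
      hVm.comp ((measurable_mixFlow ρ η).comp
        ((measurable_const.sub (measurable_fst.comp measurable_fst)).prodMk
          (measurable_snd.comp measurable_fst)))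
    refine Measurable.ite (measurableSet_le (by fun_prop) (by fun_prop)) ?_ measurable_const
    refine Measurable.mul (f := fun p : (ℝ × EuclideanSpace ℝ (Fin d) × EuclideanSpace ℝ (Fin d)) ×
      ℝ => ENNReal.ofReal (Real.exp (a * p.1.1))) (by fun_prop) ?_
    refine Measurable.ite (measurableSet_le (by fun_prop) (by fun_prop)) ?_ ?_
    · exact (Measurable.mul (by fun_prop) hm1).ennreal_ofReal
    · exact (Measurable.mul (by fun_prop) hm2).ennreal_ofReal
  have hmul : ∀ r s c : ℝ, ENNReal.ofReal (Real.exp (a * r)) *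
      ENNReal.ofReal (Real.exp (a * s) * c) = ENNReal.ofReal (Real.exp (a * (r + s)) * c) := by
    intro r s c
    rw [← ENNReal.ofReal_mul (Real.exp_pos _).le, ← mul_assoc, ← Real.exp_add, mul_add]
  have hsucc : Measurable fun ω => if T (n + 1) ω ≤ t then
      ENNReal.ofReal (Real.exp (a * T (n + 1) ω) *
        lyapunov f wstar μ (jumpChain f ρ η (1 / L) γ' (fun k => T k ω) x₀ (n + 1))) else 0 := by
    have hm := hVm.comp (hT.measurable_jumpChain (f := f) ρ η (1 / L) γ' x₀ (n + 1))
    refine Measurable.ite (measurableSet_le (hTm _) measurable_const) ?_ measurable_const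
    exact (Measurable.mul (by fun_prop) hm).ennreal_ofReal
  rw [← lintegral_add_left hsucc]
  calc _ = ∫⁻ ω, H ((T n ω, Y ω), ξ ω) ∂P := by
        refine lintegral_congr_ae ?_
        filter_upwards [hT.ae_lt] with ω hω
        have hlt := hω n
        simp only [hH, hξ]
        by_cases c1 : T n ω ≤ t
        · by_cases c2 : T (n + 1) ω ≤ t
          · rw [if_pos c2, if_neg (fun h => absurd c2 (not_le.2 h.2)), if_pos c1,
              if_pos (by linarith), hmul, add_zero, add_sub_cancel]
            rfl
          · rw [if_neg c2, if_pos ⟨c1, not_le.1 c2⟩, if_pos c1, if_neg (by linarith), hmul,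
              zero_add, add_sub_cancel]
        · rw [if_neg (by linarith), if_neg (fun h => c1 h.1), if_neg c1, add_zero]
    _ = ∫⁻ p, H p ∂((P.map fun ω => (T n ω, Y ω)).prod (expMeasure 1)) := by
        rw [← (hT.law n).map_eq, ← (hT.indepFun_jumpChain ρ η (1 / L) γ' x₀
          n).map_prod_eq_prod_map_map ((hTm n).prodMk hYm).aemeasurable hξm.aemeasurable,
          lintegral_map hHm (((hTm n).prodMk hYm).prodMk hξm)]
    _ = ∫⁻ q, ∫⁻ s, H (q, s) ∂expMeasure 1 ∂(P.map fun ω => (T n ω, Y ω)) := by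
        have := isProbabilityMeasure_expMeasure one_pos
        exact lintegral_prod _ hHm.aemeasurable
    _ ≤ ∫⁻ q, (if q.1 ≤ t then ENNReal.ofReal (Real.exp (a * q.1) *
          lyapunov f wstar μ q.2) else 0) ∂(P.map fun ω => (T n ω, Y ω)) := by
        refine lintegral_mono fun q => ?_
        by_cases c : q.1 ≤ t
        · simp only [hH, if_pos c]
          rw [lintegral_const_mul' _ _ ENNReal.ofReal_ne_top,
            ENNReal.ofReal_mul (p := Real.exp (a * q.1)) (Real.exp_pos _).le]
          exact mul_le_mul_right (lintegral_expMeasure_lyapunov_le hf hq hL hρ hμ hη h1 h2 q.2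
            (sub_nonneg.2 c)) _
        · simp [hH, if_neg c]
    _ = _ := by
        refine lintegral_map ?_ ((hTm n).prodMk hYm)
        refine Measurable.ite (measurableSet_le (by fun_prop) (by fun_prop)) ?_ measurable_const
        exact (Measurable.mul (by fun_prop) (hVm.comp measurable_snd)).ennreal_ofReal

/-- The sum collects the paths that reached the horizon before jump n, the last term those still
running; each step moves mass from the latter to the former. -/
lemma IsPoissonClock.sum_lintegral_add_le [IsProbabilityMeasure P] (hT : IsPoissonClock P T)
    (hf : IsLSmooth L f) (hq : IsStronglyQuasarConvex ρ μ f wstar)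
    (hL : 0 < L) (hρ : 0 < ρ) (hμ : 0 < μ) (hη : 0 ≤ η) (h1 : μ * γ' = η)
    (h2 : μ * γ' ^ 2 = 1 / L) (x₀ : EuclideanSpace ℝ (Fin d) × EuclideanSpace ℝ (Fin d))
    (t : ℝ) (n : ℕ) :
    ∑ k ∈ Finset.range n, ∫⁻ ω, (if T k ω ≤ t ∧ t < T (k + 1) ω then
        ENNReal.ofReal (Real.exp (ρ * η * t) * lyapunov f wstar μ (mixFlow ρ η (t - T k ω)
          (jumpChain f ρ η (1 / L) γ' (fun k => T k ω) x₀ k))) else 0) ∂P +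
    ∫⁻ ω, (if T n ω ≤ t then ENNReal.ofReal (Real.exp (ρ * η * T n ω) *
        lyapunov f wstar μ (jumpChain f ρ η (1 / L) γ' (fun k => T k ω) x₀ n)) else 0) ∂P ≤
    ENNReal.ofReal (lyapunov f wstar μ x₀) := by
  induction n with
  | zero =>
    rw [Finset.sum_range_zero, zero_add]
    calc _ ≤ ∫⁻ _, ENNReal.ofReal (lyapunov f wstar μ x₀) ∂P := by
          refine lintegral_mono fun ω => ?_
          simp only [hT.zero, jumpChain, mul_zero, Real.exp_zero, one_mul]
          split_ifs <;> simp
      _ = _ := by simp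
  | succ n ih =>
    refine le_trans ?_ ih
    rw [Finset.sum_range_succ, add_assoc, add_comm (lintegral _ _) (lintegral _ _)]
    gcongr
    exact hT.lintegral_succ_add_le hf hq hL hρ hμ hη h1 h2 x₀ t n

/-- The weighted Lyapunov function at a fixed jump time. -/
lemma IsPoissonClock.lintegral_exp_mul_lyapunov_jumpChain_le [IsProbabilityMeasure P]
    (hT : IsPoissonClock P T)
    (hf : IsLSmooth L f) (hq : IsStronglyQuasarConvex ρ μ f wstar)
    (hL : 0 < L) (hρ : 0 < ρ) (hμ : 0 < μ) (hη : 0 ≤ η) (h1 : μ * γ' = η)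
    (h2 : μ * γ' ^ 2 = 1 / L) (x₀ : EuclideanSpace ℝ (Fin d) × EuclideanSpace ℝ (Fin d)) (n : ℕ) :
    ∫⁻ ω, ENNReal.ofReal (Real.exp (ρ * η * T n ω) *
        lyapunov f wstar μ (jumpChain f ρ η (1 / L) γ' (fun k => T k ω) x₀ n)) ∂P ≤
    ENNReal.ofReal (lyapunov f wstar μ x₀) := by
  have hm : Measurable fun ω => ENNReal.ofReal (Real.exp (ρ * η * T n ω) *
      lyapunov f wstar μ (jumpChain f ρ η (1 / L) γ' (fun k => T k ω) x₀ n)) := by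
    have hTm := hT.measurable n
    exact (Measurable.mul (by fun_prop) (hf.continuous_lyapunov.measurable.comp
      (hT.measurable_jumpChain ρ η (1 / L) γ' x₀ n))).ennreal_ofReal
  -- The horizon is removed by monotone convergence along t = m.
  refine le_of_tendsto' (lintegral_tendsto_of_tendsto_of_monotone
    (f := fun (m : ℕ) ω => if T n ω ≤ m then ENNReal.ofReal (Real.exp (ρ * η * T n ω) *
      lyapunov f wstar μ (jumpChain f ρ η (1 / L) γ' (fun k => T k ω) x₀ n)) else 0)
    (fun m => ?_) (Eventually.of_forall fun ω => ?_) (Eventually.of_forall fun ω => ?_))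
    (fun m => ?_)
  · exact (Measurable.ite (measurableSet_le (hT.measurable n) measurable_const) hm
      measurable_const).aemeasurable
  · intro m m' hmm
    dsimp only
    split_ifs with c c'
    · exact le_rfl
    · exact absurd (c.trans (Nat.cast_le.2 hmm)) c'
    · exact zero_le
    · exact le_rfl
  · refine tendsto_const_nhds.congr' ?_
    filter_upwards [tendsto_natCast_atTop_atTop.eventually_ge_atTop (T n ω)] with m hm'
    rw [if_pos hm']
  · exact le_trans le_add_self (hT.sum_lintegral_add_le hf hq hL hρ hμ hη h1 h2 x₀ m n)

/-- The weighted Lyapunov function at a deterministic time. -/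
lemma IsPoissonClock.tsum_lintegral_le [IsProbabilityMeasure P] (hT : IsPoissonClock P T)
    (hf : IsLSmooth L f) (hq : IsStronglyQuasarConvex ρ μ f wstar)
    (hL : 0 < L) (hρ : 0 < ρ) (hμ : 0 < μ) (hη : 0 ≤ η) (h1 : μ * γ' = η)
    (h2 : μ * γ' ^ 2 = 1 / L) (x₀ : EuclideanSpace ℝ (Fin d) × EuclideanSpace ℝ (Fin d))
    (t : ℝ) :
    ∑' k, ∫⁻ ω, (if T k ω ≤ t ∧ t < T (k + 1) ω then
        ENNReal.ofReal (Real.exp (ρ * η * t) * lyapunov f wstar μ (mixFlow ρ η (t - T k ω)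
          (jumpChain f ρ η (1 / L) γ' (fun k => T k ω) x₀ k))) else 0) ∂P ≤
    ENNReal.ofReal (lyapunov f wstar μ x₀) := by
  rw [ENNReal.tsum_eq_iSup_nat]
  exact iSup_le fun n =>
    le_trans le_self_add (hT.sum_lintegral_add_le hf hq hL hρ hμ hη h1 h2 x₀ t n)

end Chain

/-! ### Identification of both algorithms with the jump chain. -/

section Paths

variable {d : ℕ} {ρ η γ γ' : ℝ} {f : EuclideanSpace ℝ (Fin d) → ℝ} {T : ℕ → ℝ}
  {w₀ z₀ : EuclideanSpace ℝ (Fin d)}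

lemma IsContinuizedPath.eq_jumpChain {w z : ℝ → EuclideanSpace ℝ (Fin d)} (hρ : 0 < ρ)
    (h : IsContinuizedPath f (fun _ => η) (fun _ => ρ * η) (fun _ => γ) (fun _ => γ') T w₀ z₀ w z)
    (hT0 : T 0 = 0) (hT : ∀ k, T k < T (k + 1)) (n : ℕ) :
    (w (T n), z (T n)) = jumpChain f ρ η γ γ' T (w₀, z₀) n := by
  induction n with
  | zero => simp [jumpChain, hT0, h.init_w, h.init_z]
  | succ n ih =>
    obtain ⟨wl, zl, hwl, hzl, hw, hz⟩ := h.jump n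
    have := eq_mixFlow_of_tendsto_left hρ (hT n) (h.ode_w n) (h.ode_z n) (h.right_cont_w n)
      (h.right_cont_z n) hwl hzl
    rw [jumpChain, ← ih, ← this, hw, hz]
    rfl

lemma IsContinuizedPath.eq_mixFlow_jumpChain {w z : ℝ → EuclideanSpace ℝ (Fin d)} (hρ : 0 < ρ)
    (h : IsContinuizedPath f (fun _ => η) (fun _ => ρ * η) (fun _ => γ) (fun _ => γ') T w₀ z₀ w z)
    (hT0 : T 0 = 0) (hT : ∀ k, T k < T (k + 1)) {n : ℕ} {t : ℝ} (ht : t ∈ Ico (T n) (T (n + 1))) :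
    (w t, z t) = mixFlow ρ η (t - T n) (jumpChain f ρ η γ γ' T (w₀, z₀) n) := by
  rw [← h.eq_jumpChain hρ hT0 hT n]
  exact eq_mixFlow_of_hasDerivAt hρ (h.ode_w n) (h.ode_z n) (h.right_cont_w n)
    (h.right_cont_z n) ht

lemma IsDiscretePath.eq_jumpChain {w v z : ℕ → EuclideanSpace ℝ (Fin d)} (hρ : 0 < ρ)
    (h : IsDiscretePath f
      (fun k => 1 / (1 + ρ) * (1 - Real.exp (-((1 + ρ) * η * (T (k + 1) - T k)))))
      (fun k => ρ * (1 - Real.exp (-((1 + ρ) * η * (T (k + 1) - T k)))) /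
        (ρ + Real.exp (-((1 + ρ) * η * (T (k + 1) - T k)))))
      (fun _ => γ) (fun _ => γ') w₀ z₀ w v z) (n : ℕ) :
    (w n, z n) = jumpChain f ρ η γ γ' T (w₀, z₀) n := by
  induction n with
  | zero => simp [jumpChain, h.init_w, h.init_z]
  | succ n ih =>
    have h1 : 1 + ρ ≠ 0 := by positivity
    have h2 := (add_pos hρ (Real.exp_pos (-((1 + ρ) * η * (T (n + 1) - T n))))).ne'
    have hv : v n = (mixFlow ρ η (T (n + 1) - T n) (w n, z n)).1 := by
      rw [h.step_v]
      simp only [mixFlow]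
      match_scalars <;> field_simp
    -- Since v - z = (1 - τ)(w - z) with 1 - τ = (ρ + E)/(1 + ρ), the denominator of τ' turns a step
    -- measured from v into the flow's step measured from w.
    have hz : z n + (ρ * (1 - Real.exp (-((1 + ρ) * η * (T (n + 1) - T n)))) /
        (ρ + Real.exp (-((1 + ρ) * η * (T (n + 1) - T n))))) • (v n - z n) =
        (mixFlow ρ η (T (n + 1) - T n) (w n, z n)).2 := by
      rw [h.step_v]
      simp only [mixFlow]
      match_scalars <;> field_simp <;> ring
    rw [jumpChain, ← ih, h.step_w, h.step_z, hz, hv]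
    rfl

end Paths

/-- Measurability is asked of `G` only, so the given processes, known almost surely, need no
measurability assumption. -/
lemma integrable_and_integral_le_of_lintegral_le {Ω : Type*} [MeasurableSpace Ω] {P : Measure Ω}
    {g : Ω → ℝ} {G : Ω → ENNReal} {c : ℝ} (hG : Measurable G)
    (h : ∀ᵐ ω ∂P, 0 ≤ g ω ∧ ENNReal.ofReal (g ω) = G ω)
    (hc : 0 ≤ c) (hle : ∫⁻ ω, G ω ∂P ≤ ENNReal.ofReal c) :
    Integrable g P ∧ ∫ ω, g ω ∂P ≤ c := by
  have hg : g =ᵐ[P] fun ω => (G ω).toReal := by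
    filter_upwards [h] with ω hω
    rw [← hω.2, ENNReal.toReal_ofReal hω.1]
  have hgm : AEStronglyMeasurable g P :=
    (hG.ennreal_toReal.aestronglyMeasurable).congr hg.symm
  have hg0 : 0 ≤ᵐ[P] g := h.mono fun ω hω => hω.1
  have hl : ∫⁻ ω, ENNReal.ofReal (g ω) ∂P = ∫⁻ ω, G ω ∂P :=
    lintegral_congr_ae (h.mono fun ω hω => hω.2)
  refine ⟨⟨hgm, ?_⟩, ?_⟩
  · rw [hasFiniteIntegral_iff_ofReal hg0, hl]
    exact hle.trans_lt ENNReal.ofReal_lt_top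
  · rw [integral_eq_lintegral_of_nonneg_ae hg0 hgm, hl]
    exact ENNReal.toReal_le_of_le_ofReal hc hle

/-! ### The two convergence bounds. -/

section Main

variable {d : ℕ} {L ρ μ η γ' : ℝ} {f : EuclideanSpace ℝ (Fin d) → ℝ}
  {wstar : EuclideanSpace ℝ (Fin d)} {Ω : Type*} [MeasurableSpace Ω] {P : Measure Ω}
  {T : ℕ → Ω → ℝ} {w₀ z₀ : EuclideanSpace ℝ (Fin d)}

lemma sub_le_lyapunov (hμ : 0 < μ) (x : EuclideanSpace ℝ (Fin d) × EuclideanSpace ℝ (Fin d)) :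
    f x.1 - f wstar ≤ lyapunov f wstar μ x := by
  have : 0 ≤ μ / 2 * ‖x.2 - wstar‖ ^ 2 := by positivity
  unfold lyapunov
  linarith

theorem continuized_convergence [IsProbabilityMeasure P] (hT : IsPoissonClock P T)
    (hf : IsLSmooth L f) (hq : IsStronglyQuasarConvex ρ μ f wstar)
    (hL : 0 < L) (hρ : 0 < ρ) (hμ : 0 < μ) (hη : 0 ≤ η) (h1 : μ * γ' = η)
    (h2 : μ * γ' ^ 2 = 1 / L) {w z : ℝ → Ω → EuclideanSpace ℝ (Fin d)}
    (h : ∀ᵐ ω ∂P, IsContinuizedPath f (fun _ => η) (fun _ => ρ * η) (fun _ => 1 / L) (fun _ => γ')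
      (fun k => T k ω) w₀ z₀ (fun t => w t ω) (fun t => z t ω)) {t : ℝ} (ht : 0 ≤ t) :
    Integrable (fun ω => f (w t ω) - f wstar) P ∧
      ∫ ω, (f (w t ω) - f wstar) ∂P ≤
        lyapunov f wstar μ (w₀, z₀) * Real.exp (-(ρ * η * t)) := by
  set X : ℕ → Ω → EuclideanSpace ℝ (Fin d) × EuclideanSpace ℝ (Fin d) := fun k ω =>
    mixFlow ρ η (t - T k ω) (jumpChain f ρ η (1 / L) γ' (fun k => T k ω) (w₀, z₀) k) with hX
  have hXm : ∀ k, Measurable (X k) := fun k =>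
    (measurable_mixFlow ρ η).comp ((measurable_const.sub (hT.measurable k)).prodMk
      (hT.measurable_jumpChain ρ η (1 / L) γ' (w₀, z₀) k))
  -- Almost surely exactly one summand has its condition satisfied, so `G` is a measurable version
  -- of the weighted gap at time t.
  set G : Ω → ENNReal := fun ω => ∑' k, if T k ω ≤ t ∧ t < T (k + 1) ω then
    ENNReal.ofReal (Real.exp (ρ * η * t) * (f (X k ω).1 - f wstar)) else 0 with hG
  have hms : ∀ k, MeasurableSet {ω | T k ω ≤ t ∧ t < T (k + 1) ω} := fun k =>
    (measurableSet_le (hT.measurable k) measurable_const).inter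
      (measurableSet_lt measurable_const (hT.measurable (k + 1)))
  have hterm : ∀ k, Measurable fun ω => if T k ω ≤ t ∧ t < T (k + 1) ω then
      ENNReal.ofReal (Real.exp (ρ * η * t) * (f (X k ω).1 - f wstar)) else 0 := fun k => by
    have h3 := hf.differentiable.continuous.measurable.comp (measurable_fst.comp (hXm k))
    exact Measurable.ite (hms k)
      (measurable_const.mul (h3.sub measurable_const)).ennreal_ofReal measurable_const
  have hle : ∫⁻ ω, G ω ∂P ≤ ENNReal.ofReal (lyapunov f wstar μ (w₀, z₀)) := by
    rw [hG, lintegral_tsum fun k => (hterm k).aemeasurable]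
    refine le_trans (ENNReal.tsum_le_tsum fun k => lintegral_mono fun ω => ?_)
      (hT.tsum_lintegral_le hf hq hL hρ hμ hη h1 h2 (w₀, z₀) t)
    dsimp only
    split_ifs
    · gcongr
      exact sub_le_lyapunov hμ _
    · exact le_rfl
  have hae : ∀ᵐ ω ∂P, 0 ≤ Real.exp (ρ * η * t) * (f (w t ω) - f wstar) ∧
      ENNReal.ofReal (Real.exp (ρ * η * t) * (f (w t ω) - f wstar)) = G ω := by
    filter_upwards [h, hT.ae_lt, hT.ae_tendsto_atTop] with ω hω hlt htop
    refine ⟨mul_nonneg (Real.exp_pos _).le (sub_nonneg.2 (hq.minimizer _)), ?_⟩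
    have hmono : StrictMono fun k => T k ω := strictMono_nat_of_lt_succ hlt
    obtain ⟨n, hn⟩ : ∃ n, t ∈ Ico (T n ω) (T (n + 1) ω) := by
      have hU := iUnion_Ico_map_succ_eq_Ici (f := fun k => T k ω)
        (fun k => hmono.monotone (Nat.zero_le k)) (not_bddAbove_of_tendsto_atTop htop)
      have hmem : t ∈ Ici (T 0 ω) := by rwa [hT.zero]
      exact mem_iUnion.1 (hU.ge hmem)
    rw [hG]
    dsimp only
    rw [tsum_eq_single n, if_pos (show T n ω ≤ t ∧ t < T (n + 1) ω from hn), hX]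
    · dsimp only
      rw [← hω.eq_mixFlow_jumpChain hρ (hT.zero ω) hlt hn]
    · intro m hmn
      refine if_neg fun hm => hmn ?_
      have c1 : m < n + 1 := hmono.lt_iff_lt.1 (hm.1.trans_lt hn.2)
      have c2 : n < m + 1 := hmono.lt_iff_lt.1 (hn.1.trans_lt hm.2)
      omega
  obtain ⟨hi, hb⟩ := integrable_and_integral_le_of_lintegral_le
    (Measurable.tsum hterm) hae (hq.lyapunov_nonneg hμ _) hle
  have hne := (Real.exp_pos (ρ * η * t)).ne'
  refine ⟨?_, ?_⟩
  · have := hi.const_mul (Real.exp (ρ * η * t))⁻¹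
    simpa [← mul_assoc, inv_mul_cancel₀ hne] using this
  · rw [integral_const_mul] at hb
    rw [Real.exp_neg, ← div_eq_mul_inv, le_div_iff₀ (Real.exp_pos _), mul_comm]
    exact hb

theorem discrete_convergence [IsProbabilityMeasure P] (hT : IsPoissonClock P T)
    (hf : IsLSmooth L f) (hq : IsStronglyQuasarConvex ρ μ f wstar)
    (hL : 0 < L) (hρ : 0 < ρ) (hμ : 0 < μ) (hη : 0 ≤ η) (h1 : μ * γ' = η)
    (h2 : μ * γ' ^ 2 = 1 / L) {w v z : ℕ → Ω → EuclideanSpace ℝ (Fin d)}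
    (h : ∀ᵐ ω ∂P, IsDiscretePath f
      (fun k => 1 / (1 + ρ) * (1 - Real.exp (-((1 + ρ) * η * (T (k + 1) ω - T k ω)))))
      (fun k => ρ * (1 - Real.exp (-((1 + ρ) * η * (T (k + 1) ω - T k ω)))) /
        (ρ + Real.exp (-((1 + ρ) * η * (T (k + 1) ω - T k ω)))))
      (fun _ => 1 / L) (fun _ => γ') w₀ z₀ (fun k => w k ω) (fun k => v k ω) (fun k => z k ω))
    (k : ℕ) :
    Integrable (fun ω => Real.exp (ρ * η * T k ω) * (f (w k ω) - f wstar)) P ∧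
      ∫ ω, Real.exp (ρ * η * T k ω) * (f (w k ω) - f wstar) ∂P ≤
        lyapunov f wstar μ (w₀, z₀) := by
  have hTm := hT.measurable k
  have hXm := hf.differentiable.continuous.measurable.comp
    (measurable_fst.comp (hT.measurable_jumpChain (f := f) ρ η (1 / L) γ' (w₀, z₀) k))
  refine integrable_and_integral_le_of_lintegral_le
    (G := fun ω => ENNReal.ofReal (Real.exp (ρ * η * T k ω) *
      (f (jumpChain f ρ η (1 / L) γ' (fun k => T k ω) (w₀, z₀) k).1 - f wstar)))
    (Measurable.mul (by fun_prop) (hXm.sub measurable_const)).ennreal_ofReal ?_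
    (hq.lyapunov_nonneg hμ _) ?_
  · filter_upwards [h] with ω hω
    refine ⟨mul_nonneg (Real.exp_pos _).le (sub_nonneg.2 (hq.minimizer _)), ?_⟩
    rw [← hω.eq_jumpChain hρ (T := fun k => T k ω) k]
  · refine le_trans (lintegral_mono fun ω => ?_)
      (hT.lintegral_exp_mul_lyapunov_jumpChain_le hf hq hL hρ hμ hη h1 h2 (w₀, z₀) k)
    dsimp only
    gcongr
    exact sub_le_lyapunov hμ _

end Main

theorem theorem2 {d : ℕ} {L ρ μ : ℝ} (hL : 0 < L) (hρ : 0 < ρ) (hμ : 0 < μ)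
    (f : EuclideanSpace ℝ (Fin d) → ℝ) (wstar : EuclideanSpace ℝ (Fin d))
    (hf : IsLSmooth L f) (hq : IsStronglyQuasarConvex ρ μ f wstar)
    {Ω : Type*} [MeasurableSpace Ω] (P : Measure Ω) [IsProbabilityMeasure P]
    (T : ℕ → Ω → ℝ) (hT : IsPoissonClock P T)
    (w₀ z₀ : EuclideanSpace ℝ (Fin d)) :
    (∀ w z : ℝ → Ω → EuclideanSpace ℝ (Fin d),
      (∀ᵐ ω ∂P, IsContinuizedPath f
        (fun _ => √(μ / L)) (fun _ => ρ * √(μ / L)) (fun _ => 1 / L) (fun _ => 1 / √(μ * L))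
        (fun k => T k ω) w₀ z₀ (fun t => w t ω) (fun t => z t ω)) →
      ∀ t : ℝ, 0 ≤ t →
        Integrable (fun ω => f (w t ω) - f wstar) P ∧
        ∫ ω, (f (w t ω) - f wstar) ∂P ≤
          (f w₀ - f wstar + μ / 2 * ‖z₀ - wstar‖ ^ 2) * Real.exp (-(ρ * √(μ / L) * t))) ∧
    (∀ w v z : ℕ → Ω → EuclideanSpace ℝ (Fin d),
      (∀ᵐ ω ∂P, IsDiscretePath f
        (fun k => 1 / (1 + ρ) *
          (1 - Real.exp (-((1 + ρ) * √(μ / L) * (T (k + 1) ω - T k ω)))))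
        (fun k => ρ * (1 - Real.exp (-((1 + ρ) * √(μ / L) * (T (k + 1) ω - T k ω)))) /
          (ρ + Real.exp (-((1 + ρ) * √(μ / L) * (T (k + 1) ω - T k ω)))))
        (fun _ => 1 / L) (fun _ => 1 / √(μ * L))
        w₀ z₀ (fun k => w k ω) (fun k => v k ω) (fun k => z k ω)) →
      ∀ k : ℕ,
        Integrable (fun ω => Real.exp (ρ * √(μ / L) * T k ω) * (f (w k ω) - f wstar)) P ∧
        ∫ ω, Real.exp (ρ * √(μ / L) * T k ω) * (f (w k ω) - f wstar) ∂P ≤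
          f w₀ - f wstar + μ / 2 * ‖z₀ - wstar‖ ^ 2) := by
  have hs : 0 < √(μ / L) := Real.sqrt_pos.2 (div_pos hμ hL)
  have h1 : μ * (1 / √(μ * L)) = √(μ / L) := by
    rw [mul_one_div, Real.sqrt_mul hμ.le, Real.sqrt_div hμ.le, ← div_div, Real.div_sqrt]
  have h2 : μ * (1 / √(μ * L)) ^ 2 = 1 / L := by
    rw [div_pow, Real.sq_sqrt (mul_pos hμ hL).le]
    field_simp
  exact ⟨fun w z h t ht => continuized_convergence hT hf hq hL hρ hμ hs.le h1 h2 h ht,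
    fun w v z h k => discrete_convergence hT hf hq hL hρ hμ hs.le h1 h2 h k⟩
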